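/- Let $0<\alpha\le 2$, $-1\le\beta\le 1$, $\gamma>0$, and suppose that either $\alpha\neq 1$, or $\alpha=1$ and $\beta=0$. Let $X$ be a strictly stable real random variable with index $\alpha$, skewness $\beta$, scale $\gamma$ and location $\delta=0$, i.e. with characteristic function $$E\,e^{iuX}=\exp\left(-\gamma^\alpha\left[|u|^\alpha+i\beta\,\eta(u,\alpha)\right]\right),\qquad u\in\mathbb R,$$ where $\eta(u,\alpha)=-(\operatorname{sign}u)\tan(\pi\alpha/2)\,|u|^\alpha$ for $\alpha\ne1$ and $\eta(u,1)=\frac2\pi\,u\ln|u|$. Put $\theta_0=\alpha^{-1}\arctan\left(\beta\tan(\pi\alpha/2)\right)$ if $\alpha\ne 1$ and $\theta_0=0$ if $\alpha=1$ (and $\beta=0$). Let $0<p<\alpha$. (a) With $X_+=\max(X,0)$, the moment $E X_+^p$ is finite and $$E X_+^p=\frac{\gamma^p}{(\cos\alpha\theta_0)^{p/\alpha}}\;\frac{\Gamma(1-p/\alpha)}{\Gamma(1-p)}\;\frac{\sin\left(p(\pi/2+\theta_0)\right)}{\sin(p\pi)}.$$ (b) With $X_-=\max(-X,0)$, the moment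 $E X_-^p=E(-X)_+^p$ is finite and is given by the right-hand side in (a) with $\theta_0$ replaced by $-\theta_0$. When $p=1$, the product $\Gamma(1-p)\sin(p\pi)$ in the denominator is read as its limit as $p\to1$, which is $\pi$. -/

import Mathlib

open MeasureTheory ProbabilityTheory

noncomputable section

namespace StableLaw

/-- `η(u, α) = -(sign u) tan(πα/2) |u|^α` if `α ≠ 1`, and `(2/π) u log |u|` if `α = 1`. -/
def eta (u α : ℝ) : ℝ :=
  if α = 1 then 2 / Real.pi * u * Real.log |u|
  else -(SignType.sign u : ℝ) * Real.tan (Real.pi * α / 2) * |u| ^ α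

/-- The characteristic function of the stable law with index `α`, skewness `β`, scale `γ` and
location `δ`: `φ(u) = exp(-γ^α (|u|^α + i β η(u, α)) + i u δ)`. -/
def stableCF (α β γ δ u : ℝ) : ℂ :=
  Complex.exp (-((γ ^ α : ℝ) : ℂ) * (((|u| ^ α : ℝ) : ℂ) + Complex.I * (β : ℂ) * (eta u α : ℂ))
    + Complex.I * (u : ℂ) * (δ : ℂ))

/-- The random variable `X` has the stable law with parameters `(α, β, γ, δ)` (the
parametrization `S_α(γ, β, δ)` through the characteristic function). -/
structure IsStable {Ω : Type*} [MeasurableSpace Ω] (P : Measure Ω) (X : Ω → ℝ)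
    (α β γ δ : ℝ) : Prop where
  aemeasurable : AEMeasurable X P
  alpha_pos : 0 < α
  alpha_le : α ≤ 2
  neg_one_le_beta : -1 ≤ β
  beta_le_one : β ≤ 1
  gamma_pos : 0 < γ
  charFun_eq : ∀ u : ℝ, charFun (P.map X) u = stableCF α β γ δ u

/-- The angle `θ₀ = α⁻¹ arctan(β tan(πα/2))` for `α ≠ 1`. For `α = 1` it is used only with
`β = 0` (the symmetric Cauchy law), where it is `0`. -/
def theta0 (α β : ℝ) : ℝ :=
  if α = 1 then 0 else α⁻¹ * Real.arctan (β * Real.tan (Real.pi * α / 2))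

/-- The product `Γ(1 - p) sin(pπ)`, read at `p = 1` as its limit `π`. -/
def gammaSin (p : ℝ) : ℝ :=
  if p = 1 then Real.pi else Real.Gamma (1 - p) * Real.sin (p * Real.pi)

/-- The value at `p = 1` is the limit of `Γ(1 - p) sin(pπ)` as `p → 1`. -/
theorem tendsto_gamma_mul_sin :
    Filter.Tendsto (fun p : ℝ => Real.Gamma (1 - p) * Real.sin (p * Real.pi))
      (nhdsWithin 1 {1}ᶜ) (nhds (gammaSin 1)) := by
  have hc : ContinuousAt (fun p : ℝ => Real.pi / Real.Gamma p) 1 := by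
    refine continuousAt_const.div (Real.differentiableAt_Gamma ?_).continuousAt (by simp)
    intro m h
    have : (0 : ℝ) ≤ m := m.cast_nonneg
    linarith
  have h1 : Filter.Tendsto (fun p : ℝ => Real.pi / Real.Gamma p) (nhdsWithin 1 {1}ᶜ)
      (nhds (gammaSin 1)) := by
    have := hc.tendsto
    simp only [Real.Gamma_one, div_one] at this
    simpa [gammaSin] using this.mono_left nhdsWithin_le_nhds
  refine h1.congr' ?_
  have hI : Set.Ioo (0 : ℝ) 2 ∈ nhdsWithin (1 : ℝ) {1}ᶜ :=
    mem_nhdsWithin_of_mem_nhds (Ioo_mem_nhds (by norm_num) (by norm_num))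
  filter_upwards [hI, self_mem_nhdsWithin] with p hp hp1
  have hs : Real.sin (Real.pi * p) ≠ 0 := by
    intro h0
    obtain ⟨n, hn⟩ := Real.sin_eq_zero_iff.1 h0
    have hnp : (n : ℝ) = p := mul_right_cancel₀ Real.pi_ne_zero (by rw [hn, mul_comm])
    have a : (0 : ℝ) < n := hnp ▸ hp.1
    have b : (n : ℝ) < 2 := hnp ▸ hp.2
    have a' : 0 < n := by exact_mod_cast a
    have b' : n < 2 := by exact_mod_cast b
    have : n = 1 := by omega
    exact hp1 (by rw [Set.mem_singleton_iff, ← hnp, this]; simp)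
  have hG : Real.Gamma p ≠ 0 := (Real.Gamma_pos_of_pos hp.1).ne'
  have h := Real.Gamma_mul_Gamma_one_sub p
  rw [eq_div_iff hs] at h
  rw [div_eq_iff hG, mul_comm p Real.pi]
  linarith

/-- The closed form
`γ^p / (cos αθ)^(p/α) · Γ(1 - p/α) / Γ(1 - p) · sin(p(π/2 + θ)) / sin(pπ)`,
with the product `Γ(1 - p) sin(pπ)` of the denominators read as `π` at `p = 1`. -/
def momentFormula (α γ θ p : ℝ) : ℝ :=
  γ ^ p / Real.cos (α * θ) ^ (p / α) *
    (Real.Gamma (1 - p / α) * Real.sin (p * (Real.pi / 2 + θ)) / gammaSin p)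

end StableLaw

end

section

open Filter Set Topology

/-! For `0 < p < 1`, `∫₀^∞ (1 - e^{iux}) u^{-p-1} du = (-ix)^p Γ(1-p)/p`. Averaging over the law and
using Fubini turns the left side into `∫₀^∞ (1 - φ(u)) u^{-p-1} du`. For `u > 0` the characteristic
function is `φ(u) = exp(-c e^{-iψ} u^α)` with `ψ = αθ₀` and `c = γ^α / cos ψ`, so the substitution
`t = u^α` evaluates this as `(c e^{-iψ})^{p/α} Γ(1-p/α)/p`. The result is one complex equation in
the two real unknowns `E X₊^p` and `E X₋^p` (`integral_posPart_add_negPart_rpow_of_charFun`); a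
rotation and an imaginary part isolate the first.

Finiteness for all `p < α` follows from the tail bound implied by `|1 - φ(u)| ≤ c|u|^α`. The range
`1 ≤ p < α` is reached by analytic continuation in `p` (`integral_posPart_rpow_of_charFun`), and the
negative part by applying the result to `-X`, which has skewness `-β`. -/

/-! ### Elementary bounds and Gamma integrals -/

theorem norm_one_sub_exp_neg_le_two {z : ℂ} (hz : 0 ≤ z.re) : ‖1 - Complex.exp (-z)‖ ≤ 2 := by
  calc ‖1 - Complex.exp (-z)‖ ≤ ‖(1 : ℂ)‖ + ‖Complex.exp (-z)‖ := norm_sub_le _ _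
    _ ≤ 1 + 1 := by
      gcongr
      · simp
      · rw [Complex.norm_exp]; simpa using hz
    _ = 2 := by norm_num

theorem norm_one_sub_exp_neg_le_norm {z : ℂ} (hz : 0 ≤ z.re) :
    ‖1 - Complex.exp (-z)‖ ≤ ‖z‖ := by
  have h := Convex.norm_image_sub_le_of_norm_hasDerivWithin_le (f := fun w => Complex.exp (-w))
    (f' := fun w => -Complex.exp (-w)) (s := {w : ℂ | 0 ≤ w.re}) (x := z) (y := 0) (C := 1)
    (fun w _ => by simpa using ((hasDerivAt_id w).neg.cexp).hasDerivWithinAt)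
    (fun w hw => by
      rw [norm_neg, Complex.norm_exp]; simpa using hw)
    (convex_halfSpace_re_ge 0) hz (by simp)
  simpa using h

/-- The common dominating function: `B u^a` controls the singularity at `0` since `p < a`, and `A`
controls infinity since `p > 0`. -/
theorem integrableOn_min_mul_rpow {p a : ℝ} (hp : 0 < p) (hpa : p < a) {A B : ℝ} (hA : 0 ≤ A)
    (hB : 0 ≤ B) :
    IntegrableOn (fun u : ℝ => min A (B * u ^ a) * u ^ (-p - 1)) (Ioi 0) := by
  have hm : Measurable (fun u : ℝ => min A (B * u ^ a) * u ^ (-p - 1)) := by fun_prop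
  rw [← Ioc_union_Ioi_eq_Ioi (zero_le_one' ℝ)]
  refine IntegrableOn.union ?_ ?_
  · have h : IntegrableOn (fun u : ℝ => B * u ^ (a - p - 1)) (Ioc 0 1) := by
      refine Integrable.const_mul (?_ : IntegrableOn _ _ _) B
      rw [← intervalIntegrable_iff_integrableOn_Ioc_of_le zero_le_one]
      exact intervalIntegral.intervalIntegrable_rpow' (by linarith)
    refine h.mono' hm.aestronglyMeasurable ?_
    filter_upwards [ae_restrict_mem measurableSet_Ioc] with u hu
    have hu0 : 0 < u := hu.1
    rw [Real.norm_of_nonneg (by positivity)]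
    calc min A (B * u ^ a) * u ^ (-p - 1) ≤ (B * u ^ a) * u ^ (-p - 1) := by
          gcongr; exact min_le_right _ _
      _ = B * u ^ (a - p - 1) := by
          rw [mul_assoc, ← Real.rpow_add hu0]; ring_nf
  · have h : IntegrableOn (fun u : ℝ => A * u ^ (-p - 1)) (Ioi 1) :=
      (integrableOn_Ioi_rpow_of_lt (by linarith) one_pos).const_mul A
    refine h.mono' hm.aestronglyMeasurable ?_
    filter_upwards [ae_restrict_mem measurableSet_Ioi] with u hu
    have hu0 : 0 < u := one_pos.trans hu
    rw [Real.norm_of_nonneg (by positivity)]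
    gcongr; exact min_le_left _ _

theorem norm_one_sub_exp_neg_mul_rpow_le {s t : ℝ} {w : ℂ} (hw : 0 ≤ w.re) (ht : 0 < t) :
    ‖(1 - Complex.exp (-(w * t))) * ((t ^ (-s - 1) : ℝ) : ℂ)‖ ≤
      min 2 (‖w‖ * t ^ (1 : ℝ)) * t ^ (-s - 1) := by
  have hre : 0 ≤ (w * t).re := by simpa using mul_nonneg hw ht.le
  rw [norm_mul, Complex.norm_real, Real.norm_of_nonneg (by positivity)]
  gcongr
  refine le_min (norm_one_sub_exp_neg_le_two hre) ?_
  refine (norm_one_sub_exp_neg_le_norm hre).trans ?_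
  simp [abs_of_pos ht]

theorem integrableOn_one_sub_exp_neg_mul_rpow {s : ℝ} (hs : 0 < s) (hs1 : s < 1) {w : ℂ}
    (hw : 0 ≤ w.re) :
    IntegrableOn (fun t : ℝ => (1 - Complex.exp (-(w * t))) * ((t ^ (-s - 1) : ℝ) : ℂ))
      (Ioi 0) := by
  refine (integrableOn_min_mul_rpow hs hs1 zero_le_two (norm_nonneg w)).mono' ?_ ?_
  · exact Measurable.aestronglyMeasurable (by fun_prop)
  · filter_upwards [ae_restrict_mem measurableSet_Ioi] with t ht
    exact norm_one_sub_exp_neg_mul_rpow_le hw ht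

theorem integrableOn_rpow_neg_mul_exp_neg {s r : ℝ} (hs1 : s < 1) (hr : 0 < r) :
    IntegrableOn (fun t : ℝ => t ^ (-s) * Real.exp (-(r * t))) (Ioi 0) := by
  simpa using integrableOn_rpow_mul_exp_neg_mul_rpow (p := 1) (s := -s) (b := r) (by linarith)
    one_pos hr

/-- Integration by parts against `-t^{-s}/s` reduces to Euler's integral; the boundary terms are
`O(t^{1-s})` at `0` and `O(t^{-s})` at infinity. -/
theorem integral_one_sub_exp_neg_mul_rpow_real {s r : ℝ} (hs : 0 < s) (hs1 : s < 1)
    (hr : 0 < r) :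
    ∫ t in Ioi (0 : ℝ), (1 - Real.exp (-(r * t))) * t ^ (-s - 1) =
      r ^ s * (Real.Gamma (1 - s) / s) := by
  have hbound : ∀ t : ℝ, 0 < t → ‖(1 - Real.exp (-(r * t)))‖ ≤ min 2 (r * t) := by
    intro t ht
    have h0 : 0 ≤ 1 - Real.exp (-(r * t)) := by
      have : Real.exp (-(r * t)) ≤ 1 := Real.exp_le_one_iff.2 (by nlinarith)
      linarith
    rw [Real.norm_of_nonneg h0]
    refine le_min ?_ ?_
    · linarith [Real.exp_pos (-(r * t))]
    · linarith [Real.add_one_le_exp (-(r * t))]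
  have hI : IntegrableOn (fun t : ℝ => (1 - Real.exp (-(r * t))) * t ^ (-s - 1)) (Ioi 0) := by
    refine (integrableOn_min_mul_rpow hs hs1 zero_le_two hr.le).mono' ?_ ?_
    · exact Measurable.aestronglyMeasurable (by fun_prop)
    · filter_upwards [ae_restrict_mem measurableSet_Ioi] with t (ht : 0 < t)
      rw [norm_mul, Real.norm_of_nonneg (Real.rpow_nonneg ht.le _), Real.rpow_one]
      gcongr
      exact hbound t ht
  have hJ := integrableOn_rpow_neg_mul_exp_neg hs1 hr
  have hparts := integral_Ioi_mul_deriv_eq_deriv_mul (a := 0) (a' := (0 : ℝ)) (b' := (0 : ℝ))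
    (u := fun t => 1 - Real.exp (-(r * t))) (u' := fun t => r * Real.exp (-(r * t)))
    (v := fun t => -(t ^ (-s) / s)) (v' := fun t => t ^ (-s - 1)) ?_ ?_ hI ?_ ?_ ?_
  · rw [hparts, sub_zero, zero_sub, ← integral_neg]
    have : ∀ t : ℝ, -(r * Real.exp (-(r * t)) * -(t ^ (-s) / s)) =
        r / s * (t ^ (1 - s - 1) * Real.exp (-(r * t))) := by
      intro t; rw [show 1 - s - 1 = -s by ring]; ring
    simp_rw [this]
    rw [integral_const_mul, Real.integral_rpow_mul_exp_neg_mul_Ioi (by linarith) hr, one_div,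
      Real.inv_rpow hr.le, ← Real.rpow_neg hr.le]
    have : r ^ s = r * r ^ (-(1 - s)) := by
      nth_rewrite 2 [← Real.rpow_one r]
      rw [← Real.rpow_add hr]; ring_nf
    rw [this]; ring
  · intro t _
    exact ((((hasDerivAt_id t).const_mul r).fun_neg.exp).const_sub 1).congr_deriv (by simp; ring)
  · intro t ht
    exact ((Real.hasDerivAt_rpow_const (x := t) (p := -s)
      (Or.inl (ne_of_gt ht))).div_const s).fun_neg.congr_deriv (by field_simp)
  · refine (hJ.const_mul (-(r / s))).congr ?_
    filter_upwards with t
    simp only [Pi.mul_apply]; ring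
  · refine squeeze_zero_norm' (a := fun t => r / s * t ^ (1 - s)) ?_ ?_
    · filter_upwards [self_mem_nhdsWithin] with t (ht : 0 < t)
      simp only [Pi.mul_apply]
      rw [norm_mul, norm_neg, Real.norm_of_nonneg (r := t ^ (-s) / s) (by positivity),
        sub_eq_add_neg 1 s, Real.rpow_add ht, Real.rpow_one]
      calc _ ≤ (r * t) * (t ^ (-s) / s) := by
            gcongr; exact (hbound t ht).trans (min_le_right _ _)
        _ = _ := by ring
    · have : ContinuousAt (fun t : ℝ => r / s * t ^ (1 - s)) 0 :=
        continuousAt_const.mul (Real.continuousAt_rpow_const _ _ (Or.inr (by linarith)))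
      have h := this.tendsto
      simp only [Real.zero_rpow (by linarith : 1 - s ≠ 0), mul_zero] at h
      exact h.mono_left nhdsWithin_le_nhds
  · refine squeeze_zero_norm' (a := fun t => 2 / s * t ^ (-s)) ?_ ?_
    · filter_upwards [eventually_gt_atTop 0] with t (ht : 0 < t)
      simp only [Pi.mul_apply]
      rw [norm_mul, norm_neg, Real.norm_of_nonneg (r := t ^ (-s) / s) (by positivity)]
      calc _ ≤ 2 * (t ^ (-s) / s) := by
            gcongr; exact (hbound t ht).trans (min_le_left _ _)
        _ = _ := by ring
    · simpa using (tendsto_rpow_neg_atTop hs).const_mul (2 / s)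

theorem hasDerivAt_integral_one_sub_exp_neg_mul_rpow {s : ℝ} (hs : 0 < s) (hs1 : s < 1) {w : ℂ}
    (hw : 0 < w.re) :
    HasDerivAt (fun z : ℂ => ∫ t in Ioi (0 : ℝ),
        (1 - Complex.exp (-(z * t))) * ((t ^ (-s - 1) : ℝ) : ℂ))
      (∫ t in Ioi (0 : ℝ), Complex.exp (-(w * t)) * t * ((t ^ (-s - 1) : ℝ) : ℂ)) w := by
  refine (hasDerivAt_integral_of_dominated_loc_of_deriv_le
    (s := {z : ℂ | w.re / 2 < z.re}) (μ := volume.restrict (Ioi 0))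
    (bound := fun t => t ^ (-s) * Real.exp (-(w.re / 2 * t)))
    (F := fun z t => (1 - Complex.exp (-(z * t))) * ((t ^ (-s - 1) : ℝ) : ℂ))
    (F' := fun z t => Complex.exp (-(z * t)) * t * ((t ^ (-s - 1) : ℝ) : ℂ))
    ((isOpen_lt continuous_const Complex.continuous_re).mem_nhds (by simp; linarith))
    (Eventually.of_forall fun z => Measurable.aestronglyMeasurable (by fun_prop))
    (integrableOn_one_sub_exp_neg_mul_rpow hs hs1 hw.le)
    (Measurable.aestronglyMeasurable (by fun_prop)) ?_
    (integrableOn_rpow_neg_mul_exp_neg hs1 (half_pos hw)) ?_).2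
  · filter_upwards [ae_restrict_mem measurableSet_Ioi] with t (ht : 0 < t) z (hz : w.re / 2 < z.re)
    rw [norm_mul, norm_mul, Complex.norm_real, Complex.norm_real, Real.norm_of_nonneg ht.le,
      Real.norm_of_nonneg (Real.rpow_nonneg ht.le _), Complex.norm_exp, mul_assoc]
    have h1 : t * t ^ (-s - 1) = t ^ (-s) := by
      nth_rewrite 1 [← Real.rpow_one t]
      rw [← Real.rpow_add ht]; ring_nf
    rw [h1, mul_comm]
    gcongr
    simp
    gcongr
  · filter_upwards with t z _
    exact (((((hasDerivAt_id z).mul_const (t : ℂ)).fun_neg.cexp).const_sub 1).mul_const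
      ((t ^ (-s - 1) : ℝ) : ℂ)).congr_deriv (by simp)

/-- Both sides are holomorphic on the right half-plane and agree at real points accumulating at `1`.
-/
theorem integral_one_sub_exp_neg_mul_rpow_of_re_pos {s : ℝ} (hs : 0 < s) (hs1 : s < 1) {w : ℂ}
    (hw : 0 < w.re) :
    ∫ t in Ioi (0 : ℝ), (1 - Complex.exp (-(w * t))) * ((t ^ (-s - 1) : ℝ) : ℂ) =
      w ^ (s : ℂ) * ((Real.Gamma (1 - s) / s : ℝ) : ℂ) := by
  have hopen : IsOpen {z : ℂ | 0 < z.re} := isOpen_lt continuous_const Complex.continuous_re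
  have hF : AnalyticOnNhd ℂ (fun z : ℂ => ∫ t in Ioi (0 : ℝ),
      (1 - Complex.exp (-(z * t))) * ((t ^ (-s - 1) : ℝ) : ℂ)) {z : ℂ | 0 < z.re} :=
    DifferentiableOn.analyticOnNhd (fun z hz =>
      (hasDerivAt_integral_one_sub_exp_neg_mul_rpow hs hs1
        hz).differentiableAt.differentiableWithinAt) hopen
  have hG : AnalyticOnNhd ℂ (fun z : ℂ => z ^ (s : ℂ) * ((Real.Gamma (1 - s) / s : ℝ) : ℂ))
      {z : ℂ | 0 < z.re} :=
    DifferentiableOn.analyticOnNhd (fun z hz => by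
      have : z ∈ Complex.slitPlane := Or.inl hz
      exact ((differentiableAt_id.cpow_const this).mul_const _).differentiableWithinAt) hopen
  refine hF.eqOn_of_preconnected_of_frequently_eq hG (convex_halfSpace_re_gt 0).isPreconnected
    (z₀ := 1) (by simp) ?_ hw
  have hlim : Tendsto (fun r : ℝ => (r : ℂ)) (𝓝[>] 1) (𝓝[≠] 1) := by
    refine tendsto_nhdsWithin_iff.2 ⟨?_, ?_⟩
    · exact (Complex.continuous_ofReal.tendsto' 1 1 (by simp)).mono_left nhdsWithin_le_nhds
    · filter_upwards [self_mem_nhdsWithin] with r (hr : 1 < r)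
      simpa using hr.ne'
  refine hlim.frequently (Eventually.frequently ?_)
  filter_upwards [self_mem_nhdsWithin] with r (hr : 1 < r)
  have hr0 : 0 < r := one_pos.trans hr
  rw [← Complex.ofReal_cpow hr0.le, ← Complex.ofReal_mul,
    ← integral_one_sub_exp_neg_mul_rpow_real hs hs1 hr0, ← integral_complex_ofReal]
  push_cast
  rfl

/-- Extension to the imaginary axis, needed for `w = -ix`: let `ε ↓ 0` in `w + ε` by dominated
convergence. -/
theorem integral_one_sub_exp_neg_mul_rpow {s : ℝ} (hs : 0 < s) (hs1 : s < 1) {w : ℂ}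
    (hw : 0 ≤ w.re) (hw0 : w ∈ Complex.slitPlane) :
    ∫ t in Ioi (0 : ℝ), (1 - Complex.exp (-(w * t))) * ((t ^ (-s - 1) : ℝ) : ℂ) =
      w ^ (s : ℂ) * ((Real.Gamma (1 - s) / s : ℝ) : ℂ) := by
  have hlim : Tendsto (fun ε : ℝ => w + ε) (𝓝[>] 0) (𝓝 w) :=
    ((by fun_prop : Continuous fun ε : ℝ => w + ε).tendsto' 0 w (by simp)).mono_left
      nhdsWithin_le_nhds
  have hR : Tendsto (fun ε : ℝ => (w + ε) ^ (s : ℂ) * ((Real.Gamma (1 - s) / s : ℝ) : ℂ))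
      (𝓝[>] 0) (𝓝 (w ^ (s : ℂ) * ((Real.Gamma (1 - s) / s : ℝ) : ℂ))) :=
    (hlim.cpow tendsto_const_nhds hw0).mul_const _
  refine tendsto_nhds_unique ?_ hR
  have hL : Tendsto (fun ε : ℝ => ∫ t in Ioi (0 : ℝ),
      (1 - Complex.exp (-((w + ε) * t))) * ((t ^ (-s - 1) : ℝ) : ℂ)) (𝓝[>] 0)
      (𝓝 (∫ t in Ioi (0 : ℝ), (1 - Complex.exp (-(w * t))) * ((t ^ (-s - 1) : ℝ) : ℂ))) := by
    refine tendsto_integral_filter_of_dominated_convergence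
      (fun t => min 2 ((‖w‖ + 1) * t ^ (1 : ℝ)) * t ^ (-s - 1))
      (Eventually.of_forall fun ε => Measurable.aestronglyMeasurable (by fun_prop)) ?_
      (integrableOn_min_mul_rpow hs hs1 zero_le_two (by positivity)) ?_
    · filter_upwards [Ioo_mem_nhdsGT one_pos] with ε hε
      filter_upwards [ae_restrict_mem measurableSet_Ioi] with t (ht : 0 < t)
      refine (norm_one_sub_exp_neg_mul_rpow_le (by simp; linarith [hε.1]) ht).trans ?_
      gcongr
      refine (norm_add_le _ _).trans ?_
      rw [Complex.norm_real, Real.norm_of_nonneg hε.1.le]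
      linarith [hε.2]
    · filter_upwards with t
      exact ((hlim.mul_const _).neg.cexp.const_sub 1).mul_const _
  refine hL.congr' ?_
  filter_upwards [self_mem_nhdsWithin] with ε (hε : 0 < ε)
  exact integral_one_sub_exp_neg_mul_rpow_of_re_pos hs hs1 (by simp; linarith)

/-! ### Tails and absolute moments -/

theorem measureReal_abs_gt_le_of_norm_one_sub_charFun_le {μ : Measure ℝ} [IsProbabilityMeasure μ]
    {a K : ℝ} (ha : 0 < a) (hK : ∀ u, ‖1 - charFun μ u‖ ≤ K * |u| ^ a) {r : ℝ} (hr : 0 < r) :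
    μ.real {x | r < |x|} ≤ 2 * K * 2 ^ a * r ^ (-a) := by
  have hK0 : 0 ≤ K := by simpa using (norm_nonneg _).trans (hK 1)
  have hr' : 0 < 2 * r⁻¹ := by positivity
  refine (measureReal_abs_gt_le_integral_charFun hr).trans ?_
  have h : ‖∫ t in (-2 * r⁻¹)..(2 * r⁻¹), 1 - charFun μ t‖ ≤
      K * (2 * r⁻¹) ^ a * |2 * r⁻¹ - -2 * r⁻¹| := by
    refine intervalIntegral.norm_integral_le_of_norm_le_const fun t ht => (hK t).trans ?_
    rw [uIoc_of_le (by linarith)] at ht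
    gcongr
    exact abs_le.2 ⟨by linarith [ht.1], ht.2⟩
  calc _ ≤ 2⁻¹ * r * (K * (2 * r⁻¹) ^ a * |2 * r⁻¹ - -2 * r⁻¹|) := by gcongr
    _ = _ := by
      rw [abs_of_pos (by linarith), Real.mul_rpow zero_le_two (by positivity),
        Real.inv_rpow hr.le, ← Real.rpow_neg hr.le]
      field_simp
      ring

theorem integrable_abs_rpow_of_norm_one_sub_charFun_le {μ : Measure ℝ} [IsProbabilityMeasure μ]
    {a K p : ℝ} (hp : 0 < p) (hpa : p < a) (hK : ∀ u, ‖1 - charFun μ u‖ ≤ K * |u| ^ a) :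
    Integrable (fun x : ℝ => |x| ^ p) μ := by
  have hK0 : 0 ≤ K := by simpa using (norm_nonneg _).trans (hK 1)
  have ha : 0 < a := hp.trans hpa
  -- In the layer-cake integral, `t^{p-1} = t^a t^{-(a-p)-1}`. The tail bound makes probability
  -- times `t^a` bounded, while probability `≤ 1` bounds it by `t^a`; hence the exponent `a - p`.
  have hint := integrableOn_min_mul_rpow (p := a - p) (a := a) (by linarith) (by linarith)
    (A := 2 * K * 2 ^ a) (B := 1) (by positivity) zero_le_one
  refine ⟨Measurable.aestronglyMeasurable (by fun_prop), ?_⟩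
  rw [hasFiniteIntegral_iff_ofReal (ae_of_all _ fun x => by positivity),
    lintegral_rpow_eq_lintegral_meas_lt_mul μ (ae_of_all _ fun x => abs_nonneg x)
      (by fun_prop) hp]
  refine ENNReal.mul_lt_top ENNReal.ofReal_lt_top ?_
  refine lt_of_le_of_lt (setLIntegral_mono' measurableSet_Ioi ?_)
    (hint.lintegral_lt_top)
  intro t (ht : 0 < t)
  rw [← ofReal_measureReal, ← ENNReal.ofReal_mul measureReal_nonneg]
  refine ENNReal.ofReal_le_ofReal ?_
  have hsplit : t ^ (p - 1) = t ^ a * t ^ (-(a - p) - 1) := by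
    rw [← Real.rpow_add ht]; ring_nf
  rw [hsplit, ← mul_assoc]
  gcongr
  refine le_min ?_ ?_
  · calc _ ≤ (2 * K * 2 ^ a * t ^ (-a)) * t ^ a := by
          gcongr; exact measureReal_abs_gt_le_of_norm_one_sub_charFun_le ha hK ht
      _ = _ := by rw [mul_assoc, ← Real.rpow_add ht]; simp
  · gcongr
    exact measureReal_le_one

/-! ### Fubini and the two evaluations -/

theorem integral_min_mul_rpow_scale {p y : ℝ} (hp : 0 < p) (hy : 0 ≤ y) :
    ∫ u in Ioi (0 : ℝ), min 2 (y * u) * u ^ (-p - 1) =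
      y ^ p * ∫ u in Ioi (0 : ℝ), min 2 u * u ^ (-p - 1) := by
  rcases hy.eq_or_lt with rfl | hy
  · simp [Real.zero_rpow hp.ne']
  have h := integral_comp_mul_left_Ioi (fun u : ℝ => min 2 u * u ^ (-p - 1)) 0 hy
  rw [mul_zero, smul_eq_mul, eq_inv_mul_iff_mul_eq₀ hy.ne'] at h
  rw [← h, ← mul_assoc, ← integral_const_mul]
  refine setIntegral_congr_fun measurableSet_Ioi fun u (hu : 0 < u) => ?_
  have : y ^ p * y * y ^ (-p - 1) = 1 := by
    nth_rewrite 2 [← Real.rpow_one y]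
    rw [← Real.rpow_add hy, ← Real.rpow_add hy]
    ring_nf; simp
  rw [Real.mul_rpow hy.le hu.le]
  linear_combination (-(min 2 (y * u) * u ^ (-p - 1))) * this

/-- The integrand is dominated by `min 2 (|x|u) u^{-p-1}`, whose `u`-integral is by scaling a
constant times `|x|^p`. -/
theorem integrable_one_sub_exp_mul_rpow_prod {μ : Measure ℝ} [IsProbabilityMeasure μ]
    {p : ℝ} (hp : 0 < p) (hp1 : p < 1) (hμ : Integrable (fun x : ℝ => |x| ^ p) μ) :
    Integrable (Function.uncurry fun x u : ℝ =>
      (1 - Complex.exp (u * x * Complex.I)) * ((u ^ (-p - 1) : ℝ) : ℂ))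
      (μ.prod (volume.restrict (Ioi 0))) := by
  have hpos : ∀ᵐ z : ℝ × ℝ ∂μ.prod (volume.restrict (Ioi 0)), 0 < z.2 :=
    Measure.quasiMeasurePreserving_snd.ae (ae_restrict_mem measurableSet_Ioi)
  have hb : Integrable (fun z : ℝ × ℝ => min 2 (|z.1| * z.2) * z.2 ^ (-p - 1))
      (μ.prod (volume.restrict (Ioi 0))) := by
    rw [integrable_prod_iff (Measurable.aestronglyMeasurable (by fun_prop))]
    refine ⟨ae_of_all _ fun x => ?_, ?_⟩
    · simpa [IntegrableOn] using integrableOn_min_mul_rpow hp hp1 zero_le_two (abs_nonneg x)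
    · refine (hμ.mul_const (∫ u in Ioi (0 : ℝ), min 2 u * u ^ (-p - 1))).congr
        (ae_of_all _ fun x => ?_)
      simp only
      rw [← integral_min_mul_rpow_scale hp (abs_nonneg x)]
      refine setIntegral_congr_fun measurableSet_Ioi fun u (hu : 0 < u) => ?_
      exact (Real.norm_of_nonneg (by positivity)).symm
  refine hb.mono' (Measurable.aestronglyMeasurable (by fun_prop)) ?_
  filter_upwards [hpos] with z hz
  have h := norm_one_sub_exp_neg_mul_rpow_le (s := p) (w := -(z.1 * Complex.I)) (by simp) hz
  rw [show -(-((z.1 : ℂ) * Complex.I) * (z.2 : ℂ)) = z.2 * z.1 * Complex.I by ring, norm_neg,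
    norm_mul (z.1 : ℂ), Complex.norm_I, mul_one, Complex.norm_real, Real.norm_eq_abs, Real.rpow_one] at h
  exact h

theorem integral_integral_one_sub_exp_mul_rpow {μ : Measure ℝ} [IsProbabilityMeasure μ]
    {p : ℝ} (hp : 0 < p) (hp1 : p < 1) (hμ : Integrable (fun x : ℝ => |x| ^ p) μ) :
    ∫ x, (∫ u in Ioi (0 : ℝ),
      (1 - Complex.exp (u * x * Complex.I)) * ((u ^ (-p - 1) : ℝ) : ℂ)) ∂μ =
      ∫ u in Ioi (0 : ℝ), (1 - charFun μ u) * ((u ^ (-p - 1) : ℝ) : ℂ) := by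
  rw [integral_integral_swap (integrable_one_sub_exp_mul_rpow_prod hp hp1 hμ)]
  congr 1 with u
  rw [integral_mul_const, integral_sub (integrable_const _), charFun_apply_real]
  · simp
  · refine (integrable_const (1 : ℝ)).mono' (Measurable.aestronglyMeasurable (by fun_prop))
      (ae_of_all _ fun x => ?_)
    rw [← Complex.ofReal_mul, Complex.norm_exp_ofReal_mul_I]

/-- The principal argument of `-ix` is `-π/2` for `x > 0` and `π/2` for `x < 0`. -/
theorem cpow_neg_mul_I {p : ℝ} (hp : 0 < p) (x : ℝ) :
    (-(x * Complex.I)) ^ (p : ℂ) =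
      ((x⁺ ^ p : ℝ) : ℂ) * Complex.exp (-(Real.pi * p / 2 * Complex.I)) +
        ((x⁻ ^ p : ℝ) : ℂ) * Complex.exp (Real.pi * p / 2 * Complex.I) := by
  have hp' : (p : ℂ) ≠ 0 := by exact_mod_cast hp.ne'
  rcases lt_trichotomy x 0 with hx | rfl | hx
  · have hx' : 0 < -x := by linarith
    rw [posPart_eq_zero.2 hx.le, negPart_eq_neg.2 hx.le, Real.zero_rpow hp.ne',
      Real.rpow_def_of_pos hx', show -((x : ℂ) * Complex.I) = ((-x : ℝ) : ℂ) * Complex.I by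
        push_cast; ring, Complex.cpow_def_of_ne_zero (by simp [hx.ne]),
      Complex.log_ofReal_mul hx' Complex.I_ne_zero, Complex.log_I]
    simp only [Complex.ofReal_zero, zero_mul, zero_add, Complex.ofReal_exp, ← Complex.exp_add]
    congr 1
    push_cast
    ring
  · simp [hp', hp.ne']
  · rw [posPart_eq_self.2 hx.le, negPart_eq_zero.2 hx.le, Real.zero_rpow hp.ne',
      Real.rpow_def_of_pos hx, show -((x : ℂ) * Complex.I) = (x : ℂ) * -Complex.I by ring,
      Complex.cpow_def_of_ne_zero (by simp [hx.ne']),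
      Complex.log_ofReal_mul hx (by simp), Complex.log_neg_I]
    simp only [Complex.ofReal_zero, zero_mul, add_zero, Complex.ofReal_exp, ← Complex.exp_add]
    congr 1
    push_cast
    ring

theorem integral_one_sub_exp_mul_I_mul_rpow {p : ℝ} (hp : 0 < p) (hp1 : p < 1) (x : ℝ) :
    ∫ u in Ioi (0 : ℝ), (1 - Complex.exp (u * x * Complex.I)) * ((u ^ (-p - 1) : ℝ) : ℂ) =
      (((x⁺ ^ p : ℝ) : ℂ) * Complex.exp (-(Real.pi * p / 2 * Complex.I)) +
        ((x⁻ ^ p : ℝ) : ℂ) * Complex.exp (Real.pi * p / 2 * Complex.I)) *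
        ((Real.Gamma (1 - p) / p : ℝ) : ℂ) := by
  rcases eq_or_ne x 0 with rfl | hx
  · simp [hp.ne']
  rw [← cpow_neg_mul_I hp, ← integral_one_sub_exp_neg_mul_rpow hp hp1 (by simp)
    (Or.inr (by simpa using hx))]
  congr 1 with u
  congr 3
  ring

theorem integral_one_sub_exp_neg_mul_rpow_mul_rpow {a p : ℝ} (hp : 0 < p) (hpa : p < a) {w : ℂ}
    (hw : 0 < w.re) :
    ∫ u in Ioi (0 : ℝ), (1 - Complex.exp (-(w * ((u ^ a : ℝ) : ℂ)))) *
        ((u ^ (-p - 1) : ℝ) : ℂ) =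
      w ^ ((p / a : ℝ) : ℂ) * ((Real.Gamma (1 - p / a) / p : ℝ) : ℂ) := by
  have ha : 0 < a := hp.trans hpa
  have h := integral_one_sub_exp_neg_mul_rpow_of_re_pos (s := p / a) (by positivity)
    ((div_lt_one ha).2 hpa) hw
  rw [← integral_comp_rpow_Ioi _ ha.ne'] at h
  have h2 : ∀ u ∈ Ioi (0 : ℝ), (|a| * u ^ (a - 1)) •
      ((1 - Complex.exp (-(w * ((u ^ a : ℝ) : ℂ)))) * (((u ^ a) ^ (-(p / a) - 1) : ℝ) : ℂ)) =
      (a : ℂ) * ((1 - Complex.exp (-(w * ((u ^ a : ℝ) : ℂ)))) * ((u ^ (-p - 1) : ℝ) : ℂ)) := by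
    intro u (hu : 0 < u)
    have : u ^ (-p - 1) = u ^ (a - 1) * (u ^ a) ^ (-(p / a) - 1) := by
      rw [← Real.rpow_mul hu.le, ← Real.rpow_add hu]
      congr 1
      field_simp
      ring
    rw [this, abs_of_pos ha, Complex.real_smul]
    push_cast
    ring
  rw [setIntegral_congr_fun measurableSet_Ioi h2, integral_const_mul] at h
  have ha' : (a : ℂ) ≠ 0 := by exact_mod_cast ha.ne'
  refine mul_left_cancel₀ ha' (h.trans ?_)
  have : Real.Gamma (1 - p / a) / (p / a) = a * (Real.Gamma (1 - p / a) / p) := by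
    field_simp
  rw [this]
  push_cast
  ring

theorem integrable_posPart_rpow {μ : Measure ℝ} {p : ℝ} (hp : 0 < p)
    (hμ : Integrable (fun x : ℝ => |x| ^ p) μ) : Integrable (fun x : ℝ => x⁺ ^ p) μ := by
  refine hμ.mono' (Measurable.aestronglyMeasurable ?_) (ae_of_all _ fun x => ?_)
  · have : Measurable fun x : ℝ => max x 0 := by fun_prop
    exact this.pow_const p
  · have h0 := posPart_nonneg x
    rw [Real.norm_of_nonneg (by positivity)]
    gcongr
    exact max_le (le_abs_self x) (abs_nonneg x)

theorem integrable_negPart_rpow {μ : Measure ℝ} {p : ℝ} (hp : 0 < p)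
    (hμ : Integrable (fun x : ℝ => |x| ^ p) μ) : Integrable (fun x : ℝ => x⁻ ^ p) μ := by
  refine hμ.mono' (Measurable.aestronglyMeasurable ?_) (ae_of_all _ fun x => ?_)
  · have : Measurable fun x : ℝ => max (-x) 0 := by fun_prop
    exact this.pow_const p
  · have h0 := negPart_nonneg x
    rw [Real.norm_of_nonneg (by positivity)]
    gcongr
    exact max_le (neg_le_abs x) (abs_nonneg x)

theorem re_ofReal_mul_exp_neg_pos {c ψ : ℝ} (hc : 0 < c)
    (hψ : ψ ∈ Ioo (-(Real.pi / 2)) (Real.pi / 2)) :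
    0 < ((c : ℂ) * Complex.exp (-(ψ * Complex.I))).re := by
  rw [← neg_mul, ← Complex.ofReal_neg, Complex.re_ofReal_mul, Complex.exp_ofReal_mul_I_re,
    Real.cos_neg]
  exact mul_pos hc (Real.cos_pos_of_mem_Ioo hψ)

theorem cpow_ofReal_mul_exp_neg {c ψ : ℝ} (hc : 0 < c)
    (hψ : ψ ∈ Ioo (-(Real.pi / 2)) (Real.pi / 2)) (s : ℝ) :
    ((c : ℂ) * Complex.exp (-(ψ * Complex.I))) ^ (s : ℂ) =
      ((c ^ s : ℝ) : ℂ) * Complex.exp (-(ψ * s * Complex.I)) := by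
  have h1 : -Real.pi < (-(ψ * Complex.I)).im := by
    have := hψ.2; simp; linarith [Real.pi_pos]
  have h2 : (-(ψ * Complex.I)).im ≤ Real.pi := by
    have := hψ.1; simp; linarith [Real.pi_pos]
  have hc' : (c : ℂ) ≠ 0 := by exact_mod_cast hc.ne'
  rw [Complex.cpow_def_of_ne_zero (mul_ne_zero hc' (Complex.exp_ne_zero _)),
    Complex.log_ofReal_mul hc (Complex.exp_ne_zero _), Complex.log_exp h1 h2,
    Real.rpow_def_of_pos hc, Complex.ofReal_exp, ← Complex.exp_add]
  congr 1
  push_cast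
  ring

/-! ### Moments when `φ(u) = exp(-c e^{-iψ} u^a)` for `u > 0` -/

section

variable {μ : Measure ℝ} [IsProbabilityMeasure μ] {a c ψ : ℝ}

theorem norm_one_sub_charFun_le_of_eq_exp (hc : 0 < c)
    (hψ : ψ ∈ Ioo (-(Real.pi / 2)) (Real.pi / 2)) (ha : 0 < a)
    (hφ : ∀ u : ℝ, 0 < u → charFun μ u =
      Complex.exp (-(c * Complex.exp (-(ψ * Complex.I)) * ((u ^ a : ℝ) : ℂ)))) (u : ℝ) :
    ‖1 - charFun μ u‖ ≤ c * |u| ^ a := by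
  have hpos : ∀ u : ℝ, 0 < u → ‖1 - charFun μ u‖ ≤ c * u ^ a := by
    intro u hu
    rw [hφ u hu]
    refine (norm_one_sub_exp_neg_le_norm ?_).trans_eq ?_
    · rw [Complex.re_mul_ofReal]
      exact mul_nonneg (re_ofReal_mul_exp_neg_pos hc hψ).le (by positivity)
    · rw [norm_mul, norm_mul, Complex.norm_real, Complex.norm_real, Real.norm_of_nonneg hc.le,
        Real.norm_of_nonneg (by positivity), Complex.norm_exp]
      simp
  rcases lt_trichotomy u 0 with hu | rfl | hu
  · have h := hpos (-u) (by linarith)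
    rw [charFun_neg, ← Complex.norm_conj] at h
    rw [abs_of_neg hu]
    simpa using h
  · simp [ha.ne']
  · rw [abs_of_pos hu]
    exact hpos u hu

theorem integral_posPart_add_negPart_rpow_of_charFun (hc : 0 < c)
    (hψ : ψ ∈ Ioo (-(Real.pi / 2)) (Real.pi / 2))
    (hφ : ∀ u : ℝ, 0 < u → charFun μ u =
      Complex.exp (-(c * Complex.exp (-(ψ * Complex.I)) * ((u ^ a : ℝ) : ℂ))))
    {p : ℝ} (hp : 0 < p) (hpa : p < a) (hp1 : p < 1) :
    (((∫ x, x⁺ ^ p ∂μ : ℝ) : ℂ) * Complex.exp (-(Real.pi * p / 2 * Complex.I)) +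
      ((∫ x, x⁻ ^ p ∂μ : ℝ) : ℂ) * Complex.exp (Real.pi * p / 2 * Complex.I)) *
        (Real.Gamma (1 - p) : ℂ) =
      ((c ^ (p / a) * Real.Gamma (1 - p / a) : ℝ) : ℂ) *
        Complex.exp (-(ψ / a * p * Complex.I)) := by
  have ha : 0 < a := hp.trans hpa
  have hμ := integrable_abs_rpow_of_norm_one_sub_charFun_le hp hpa
    (norm_one_sub_charFun_le_of_eq_exp hc hψ ha hφ)
  have h := integral_integral_one_sub_exp_mul_rpow hp hp1 hμ
  have hR : ∫ u in Ioi (0 : ℝ), (1 - charFun μ u) * ((u ^ (-p - 1) : ℝ) : ℂ) =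
      ∫ u in Ioi (0 : ℝ), (1 - Complex.exp (-(c * Complex.exp (-(ψ * Complex.I)) *
        ((u ^ a : ℝ) : ℂ)))) * ((u ^ (-p - 1) : ℝ) : ℂ) :=
    setIntegral_congr_fun measurableSet_Ioi fun u hu => by simp only [hφ u hu]
  simp_rw [integral_one_sub_exp_mul_I_mul_rpow hp hp1] at h
  rw [hR, integral_one_sub_exp_neg_mul_rpow_mul_rpow hp hpa (re_ofReal_mul_exp_neg_pos hc hψ),
    cpow_ofReal_mul_exp_neg hc hψ, integral_mul_const, integral_add, integral_mul_const,
    integral_mul_const, integral_complex_ofReal, integral_complex_ofReal] at h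
  · have hp' : (p : ℂ) ≠ 0 := by exact_mod_cast hp.ne'
    push_cast at h ⊢
    rw [← mul_div_assoc, ← mul_div_assoc, div_left_inj' hp'] at h
    rw [h, show (ψ : ℂ) * (p / a) = ψ / a * p by ring]
    ring
  · exact (integrable_posPart_rpow hp hμ).ofReal.mul_const _
  · exact (integrable_negPart_rpow hp hμ).ofReal.mul_const _

/-- Multiplying by `e^{-iπp/2}` makes the negative-part term real, so it drops out of the imaginary
part. Euler's reflection formula then trades `Γ(1-p) sin(πp)` for `π/Γ(p)`, a form regular at `p =
1`. -/
theorem integral_posPart_rpow_of_charFun_of_lt_one (hc : 0 < c)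
    (hψ : ψ ∈ Ioo (-(Real.pi / 2)) (Real.pi / 2))
    (hφ : ∀ u : ℝ, 0 < u → charFun μ u =
      Complex.exp (-(c * Complex.exp (-(ψ * Complex.I)) * ((u ^ a : ℝ) : ℂ))))
    {p : ℝ} (hp : 0 < p) (hpa : p < a) (hp1 : p < 1) :
    ∫ x, x⁺ ^ p ∂μ = c ^ (p / a) * Real.Gamma (1 - p / a) *
      Real.sin (p * (Real.pi / 2 + ψ / a)) * Real.Gamma p / Real.pi := by
  have h := integral_posPart_add_negPart_rpow_of_charFun hc hψ hφ hp hpa hp1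
  have h2 : (((∫ x, x⁺ ^ p ∂μ : ℝ) : ℂ) * Complex.exp (((-(Real.pi * p) : ℝ) : ℂ) * Complex.I) +
      ((∫ x, x⁻ ^ p ∂μ : ℝ) : ℂ)) * (Real.Gamma (1 - p) : ℂ) =
      ((c ^ (p / a) * Real.Gamma (1 - p / a) : ℝ) : ℂ) *
        Complex.exp (((-(p * (Real.pi / 2 + ψ / a)) : ℝ) : ℂ) * Complex.I) := by
    have e1 : Complex.exp (((-(Real.pi * p) : ℝ) : ℂ) * Complex.I) =
        Complex.exp (-(Real.pi * p / 2 * Complex.I)) *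
          Complex.exp (-(Real.pi * p / 2 * Complex.I)) := by
      rw [← Complex.exp_add]; congr 1; push_cast; ring
    have e2 : Complex.exp (Real.pi * p / 2 * Complex.I) *
        Complex.exp (-(Real.pi * p / 2 * Complex.I)) = 1 := by
      rw [← Complex.exp_add]; simp
    have e3 : Complex.exp (((-(p * (Real.pi / 2 + ψ / a)) : ℝ) : ℂ) * Complex.I) =
        Complex.exp (-(ψ / a * p * Complex.I)) *
          Complex.exp (-(Real.pi * p / 2 * Complex.I)) := by
      rw [← Complex.exp_add]; congr 1; push_cast; ring
    rw [e1, e3]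
    linear_combination Complex.exp (-(Real.pi * p / 2 * Complex.I)) * h -
      ((∫ x, x⁻ ^ p ∂μ : ℝ) : ℂ) * (Real.Gamma (1 - p) : ℂ) * e2
  have h3 := congrArg Complex.im h2
  rw [Complex.im_mul_ofReal, Complex.im_ofReal_mul, Complex.add_im, Complex.im_ofReal_mul,
    Complex.ofReal_im, Complex.exp_ofReal_mul_I_im, Complex.exp_ofReal_mul_I_im,
    Real.sin_neg, Real.sin_neg] at h3
  have hG := Real.Gamma_mul_Gamma_one_sub p
  have hs : 0 < Real.sin (Real.pi * p) :=
    Real.sin_pos_of_pos_of_lt_pi (by positivity) (by nlinarith [Real.pi_pos])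
  rw [eq_div_iff hs.ne'] at hG
  rw [eq_div_iff Real.pi_ne_zero]
  linear_combination (-Real.Gamma p) * h3 - (∫ x, x⁺ ^ p ∂μ) * hG

theorem analyticAt_Gamma {x : ℝ} (hx : 0 < x) : AnalyticAt ℝ Real.Gamma x := by
  have hopen : IsOpen {z : ℂ | 0 < z.re} := isOpen_lt continuous_const Complex.continuous_re
  have h : AnalyticAt ℂ Complex.Gamma x :=
    DifferentiableOn.analyticAt (s := {z : ℂ | 0 < z.re}) (fun z hz =>
      (Complex.differentiableAt_Gamma z fun m h => by
        have hz' : 0 < z.re := hz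
        rw [h] at hz'
        simp only [Complex.neg_re, Complex.natCast_re] at hz'
        linarith [m.cast_nonneg (α := ℝ)]).differentiableWithinAt)
      (hopen.mem_nhds (by simpa using hx))
  exact h.re_ofReal

/-- Since `x^p = e^{p log x}` for `x > 0`, analyticity of moment generating functions gives
analyticity in `p`. -/
theorem mgf_log_restrict_Ioi {ν : Measure ℝ} {p : ℝ} (hp : p ≠ 0) :
    mgf Real.log (ν.restrict (Ioi 0)) p = ∫ x, x⁺ ^ p ∂ν := by
  rw [mgf, ← integral_indicator measurableSet_Ioi]
  congr 1 with x
  by_cases hx : 0 < x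
  · rw [indicator_of_mem (show x ∈ Ioi 0 from hx), posPart_eq_self.2 hx.le,
      Real.rpow_def_of_pos hx, mul_comm]
  · rw [indicator_of_notMem (show x ∉ Ioi 0 from hx), posPart_eq_zero.2 (not_lt.1 hx),
      Real.zero_rpow hp]

theorem mem_integrableExpSet_log_restrict_Ioi {ν : Measure ℝ} {p : ℝ}
    (h : Integrable (fun x : ℝ => x⁺ ^ p) ν) :
    p ∈ integrableExpSet Real.log (ν.restrict (Ioi 0)) := by
  refine (h.integrableOn (s := Ioi 0)).congr ?_
  filter_upwards [ae_restrict_mem measurableSet_Ioi] with x (hx : 0 < x)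
  rw [posPart_eq_self.2 hx.le, Real.rpow_def_of_pos hx, mul_comm]

theorem integral_posPart_rpow_of_charFun (hc : 0 < c)
    (hψ : ψ ∈ Ioo (-(Real.pi / 2)) (Real.pi / 2))
    (hφ : ∀ u : ℝ, 0 < u → charFun μ u =
      Complex.exp (-(c * Complex.exp (-(ψ * Complex.I)) * ((u ^ a : ℝ) : ℂ))))
    {p : ℝ} (hp : 0 < p) (hpa : p < a) :
    ∫ x, x⁺ ^ p ∂μ = c ^ (p / a) * Real.Gamma (1 - p / a) *
      Real.sin (p * (Real.pi / 2 + ψ / a)) * Real.Gamma p / Real.pi := by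
  have ha : 0 < a := hp.trans hpa
  have hsub : Ioo 0 a ⊆ interior (integrableExpSet Real.log (μ.restrict (Ioi 0))) := by
    refine interior_maximal (fun q hq => ?_) isOpen_Ioo
    exact mem_integrableExpSet_log_restrict_Ioi (integrable_posPart_rpow hq.1
      (integrable_abs_rpow_of_norm_one_sub_charFun_le hq.1 hq.2
        (norm_one_sub_charFun_le_of_eq_exp hc hψ ha hφ)))
  have hF : AnalyticOnNhd ℝ (mgf Real.log (μ.restrict (Ioi 0))) (Ioo 0 a) :=
    analyticOnNhd_mgf.mono hsub
  have hG : AnalyticOnNhd ℝ (fun q => Real.exp (Real.log c * (q / a)) * Real.Gamma (1 - q / a) *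
      Real.sin (q * (Real.pi / 2 + ψ / a)) * Real.Gamma q / Real.pi) (Ioo 0 a) := by
    intro q hq
    have h1 : AnalyticAt ℝ (fun q : ℝ => Real.Gamma (1 - q / a)) q :=
      (analyticAt_Gamma (sub_pos.2 ((div_lt_one ha).2 hq.2))).fun_comp
        (f := fun q : ℝ => 1 - q / a) (analyticAt_const.sub analyticAt_id.div_const)
    have h2 := analyticAt_Gamma hq.1
    have h3 : AnalyticAt ℝ (fun q : ℝ => Real.exp (Real.log c * (q / a))) q :=
      (analyticAt_const.mul (analyticAt_id.div_const)).rexp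
    have h4 : AnalyticAt ℝ (fun q : ℝ => Real.sin (q * (Real.pi / 2 + ψ / a))) q :=
      Real.analyticAt_sin.fun_comp (analyticAt_id.mul analyticAt_const)
    exact (((h3.mul h1).mul h4).mul h2).div_const
  -- The formula is known for `p < min a 1`; the midpoint of that interval is the base point for the
  -- identity theorem on `(0, a)`.
  have hm : 0 < min a 1 := lt_min ha one_pos
  have hmem : min a 1 / 2 ∈ Ioo 0 (min a 1) := ⟨by linarith, by linarith⟩
  have heq := hF.eqOn_of_preconnected_of_eventuallyEq hG isPreconnected_Ioo
    (z₀ := min a 1 / 2) ⟨hmem.1, hmem.2.trans_le (min_le_left _ _)⟩ (by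
      filter_upwards [isOpen_Ioo.mem_nhds hmem] with q hq
      rw [mgf_log_restrict_Ioi hq.1.ne', ← Real.rpow_def_of_pos hc]
      exact integral_posPart_rpow_of_charFun_of_lt_one hc hψ hφ hq.1
        (hq.2.trans_le (min_le_left _ _)) (hq.2.trans_le (min_le_right _ _))) ⟨hp, hpa⟩
  rw [mgf_log_restrict_Ioi hp.ne'] at heq
  simpa only [← Real.rpow_def_of_pos hc] using heq

end

/-! ### Translation to the stable parameters -/

namespace StableLaw

theorem gammaSin_eq {p : ℝ} (hp : 0 < p) (hp2 : p < 2) : gammaSin p = Real.pi / Real.Gamma p := by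
  unfold gammaSin
  split_ifs with h
  · simp [h]
  have hs : Real.sin (Real.pi * p) ≠ 0 := by
    intro h0
    obtain ⟨n, hn⟩ := Real.sin_eq_zero_iff.1 h0
    have hnp : (n : ℝ) = p := mul_right_cancel₀ Real.pi_ne_zero (by rw [hn, mul_comm])
    have a : (0 : ℝ) < n := hnp ▸ hp
    have b : (n : ℝ) < 2 := hnp ▸ hp2
    have a' : 0 < n := by exact_mod_cast a
    have b' : n < 2 := by exact_mod_cast b
    have : n = 1 := by omega
    exact h (by rw [← hnp, this]; simp)
  have hG := Real.Gamma_mul_Gamma_one_sub p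
  rw [eq_div_iff hs] at hG
  rw [eq_div_iff (Real.Gamma_pos_of_pos hp).ne', mul_comm p]
  linarith

theorem mul_theta0 {α β : ℝ} (hα : 0 < α) (hstrict : α ≠ 1 ∨ (α = 1 ∧ β = 0)) :
    α * theta0 α β = Real.arctan (β * Real.tan (Real.pi * α / 2)) := by
  unfold theta0
  split_ifs with h
  · rcases hstrict with h' | ⟨-, rfl⟩
    · exact absurd h h'
    · simp
  · field_simp

theorem theta0_neg (α β : ℝ) : theta0 α (-β) = -theta0 α β := by
  unfold theta0
  split_ifs <;> simp [Real.arctan_neg]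

/-- With `ψ = αθ₀`, the bracket is `u^α (1 - i tan ψ)`, and `1 - i tan ψ = e^{-iψ} / cos ψ`. -/
theorem stableCF_eq {α β γ : ℝ} (hα : 0 < α) (hstrict : α ≠ 1 ∨ (α = 1 ∧ β = 0)) {u : ℝ}
    (hu : 0 < u) :
    stableCF α β γ 0 u = Complex.exp (-(((γ ^ α / Real.cos (α * theta0 α β) : ℝ) : ℂ) *
      Complex.exp (-(((α * theta0 α β : ℝ) : ℂ) * Complex.I)) * ((u ^ α : ℝ) : ℂ))) := by
  have hη : β * eta u α = -(Real.tan (α * theta0 α β) * u ^ α) := by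
    rw [mul_theta0 hα hstrict, Real.tan_arctan]
    unfold eta
    split_ifs with h
    · rcases hstrict with h' | ⟨-, rfl⟩
      · exact absurd h h'
      · simp
    · rw [sign_pos hu, abs_of_pos hu]
      simp
      ring
  have hcos : Real.cos (α * theta0 α β) ≠ 0 := by
    rw [mul_theta0 hα hstrict]
    exact (Real.cos_arctan_pos _).ne'
  unfold stableCF
  congr 1
  rw [mul_assoc Complex.I, ← Complex.ofReal_mul, hη, abs_of_pos hu, Real.tan_eq_sin_div_cos,
    ← neg_mul ((α * theta0 α β : ℝ) : ℂ), ← Complex.ofReal_neg (α * theta0 α β), Complex.exp_mul_I, ← Complex.ofReal_cos,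
    ← Complex.ofReal_sin, Real.cos_neg, Real.sin_neg]
  generalize Real.cos (α * theta0 α β) = C at *
  have hC : (C : ℂ) ≠ 0 := by exact_mod_cast hcos
  push_cast
  field_simp
  ring

variable {μ : Measure ℝ} [IsProbabilityMeasure μ] {α β γ p : ℝ}

theorem integral_posPart_rpow (hα : 0 < α) (hα2 : α ≤ 2) (hγ : 0 < γ)
    (hstrict : α ≠ 1 ∨ (α = 1 ∧ β = 0)) (hμ : ∀ u, charFun μ u = stableCF α β γ 0 u)
    (hp : 0 < p) (hpα : p < α) :
    Integrable (fun x : ℝ => |x| ^ p) μ ∧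
      ∫ x, x⁺ ^ p ∂μ = momentFormula α γ (theta0 α β) p := by
  have hcos : 0 < Real.cos (α * theta0 α β) := by
    rw [mul_theta0 hα hstrict]
    exact Real.cos_arctan_pos _
  have hψ : α * theta0 α β ∈ Ioo (-(Real.pi / 2)) (Real.pi / 2) := by
    rw [mul_theta0 hα hstrict]
    exact Real.arctan_mem_Ioo _
  have hc : 0 < γ ^ α / Real.cos (α * theta0 α β) := by positivity
  have hφ := fun u hu => (hμ u).trans (stableCF_eq (γ := γ) hα hstrict hu)
  refine ⟨integrable_abs_rpow_of_norm_one_sub_charFun_le hp hpα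
    (norm_one_sub_charFun_le_of_eq_exp hc hψ hα hφ), ?_⟩
  rw [integral_posPart_rpow_of_charFun hc hψ hφ hp hpα, momentFormula,
    gammaSin_eq hp (hpα.trans_le hα2), Real.div_rpow (by positivity) hcos.le,
    ← Real.rpow_mul hγ.le, mul_div_cancel₀ _ hα.ne', mul_div_cancel_left₀ _ hα.ne']
  have := (Real.Gamma_pos_of_pos hp).ne'
  field_simp

theorem stableCF_neg (α β γ u : ℝ) : stableCF α (-β) γ 0 u = stableCF α β γ 0 (-u) := by
  have h : eta (-u) α = -eta u α := by
    unfold eta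
    split_ifs
    · simp
    · rw [Left.sign_neg, abs_neg]; simp
  unfold stableCF
  rw [h, abs_neg]
  push_cast
  congr 1
  ring

end StableLaw

end

theorem mainTheorem2 {Ω : Type*} [MeasurableSpace Ω] (P : Measure Ω) [IsProbabilityMeasure P]
    (X : Ω → ℝ) (α β γ p : ℝ)
    (hX : StableLaw.IsStable P X α β γ 0)
    (hstrict : α ≠ 1 ∨ (α = 1 ∧ β = 0))
    (hp : 0 < p) (hpα : p < α) :
    (Integrable (fun ω => ((X ω)⁺) ^ p) P ∧
      ∫ ω, ((X ω)⁺) ^ p ∂P = StableLaw.momentFormula α γ (StableLaw.theta0 α β) p) ∧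
    (Integrable (fun ω => ((X ω)⁻) ^ p) P ∧
      ∫ ω, ((X ω)⁻) ^ p ∂P = ∫ ω, ((-X ω)⁺) ^ p ∂P ∧
      ∫ ω, ((X ω)⁻) ^ p ∂P = StableLaw.momentFormula α γ (-StableLaw.theta0 α β) p) := by
  have hpos : ∀ (Y : Ω → ℝ) (b : ℝ), AEMeasurable Y P → (α ≠ 1 ∨ (α = 1 ∧ b = 0)) →
      (∀ u, charFun (P.map Y) u = StableLaw.stableCF α b γ 0 u) →
      Integrable (fun ω => ((Y ω)⁺) ^ p) P ∧
        ∫ ω, ((Y ω)⁺) ^ p ∂P = StableLaw.momentFormula α γ (StableLaw.theta0 α b) p := by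
    intro Y b hY hb hφ
    have : IsProbabilityMeasure (P.map Y) := Measure.isProbabilityMeasure_map hY
    obtain ⟨hint, hval⟩ := StableLaw.integral_posPart_rpow hX.alpha_pos hX.alpha_le hX.gamma_pos
      hb hφ hp hpα
    have hint' := integrable_posPart_rpow hp hint
    exact ⟨hint'.comp_aemeasurable hY, by
      rw [← hval, integral_map hY hint'.aestronglyMeasurable]⟩
  -- Reflecting `X` replaces `u` by `-u`, which amounts to `β ↦ -β` because `eta` is odd in `u`.
  have hneg := hpos (fun ω => -X ω) (-β) hX.aemeasurable.neg (by simpa using hstrict) (by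
    intro u
    rw [StableLaw.stableCF_neg, ← hX.charFun_eq, charFun_apply_real, charFun_apply_real,
      integral_map hX.aemeasurable.fun_neg (Measurable.aestronglyMeasurable (by fun_prop)),
      integral_map hX.aemeasurable (Measurable.aestronglyMeasurable (by fun_prop))]
    simp)
  rw [StableLaw.theta0_neg] at hneg
  simp only [posPart_neg] at hneg ⊢
  exact ⟨hpos X β hX.aemeasurable hstrict hX.charFun_eq, hneg.1, trivial, hneg.2⟩
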